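/- Consider a seller offering $n\ge 1$ items to a single additive, risk-neutral buyer whose item values $v=(v_1,\dots,v_n)\in\mathbb{R}_{\ge 0}^n$ are drawn from a product distribution $F=F_1\times\cdots\times F_n$, where each $F_i$ is an arbitrary probability distribution on $\mathbb{R}_{\ge 0}$. An auction (incentive compatible and individually rational) is a possibly infinite menu $\mathcal{M}\subseteq[0,1]^n\times\mathbb{R}_{\ge 0}$ of entries $(x;p)$ (allocation probabilities $x$ and price $p$) that contains $(0;0)$ and in which, for every type $v\in\mathbb{R}_{\ge 0}^n$, some entry maximizes the utility $\sum_i x_iv_i-p$. Its menu size is the number of its entries other than $(0;0)$, and its revenue from $F$ is $\mathbb{E}_{v\sim F}[p(v)]$, where $p(v)$ is the price of the utility-maximizing entry of type $v$, with ties broken in favor of higher prices (the supremum of the tied prices, if it is not attained). Let $\mathrm{Rev}(F)\in[0,\infty]$ be the supremum of the revenues from $F$ of all auctions, and $\mathrm{Rev}_C(F)$ the supremum over auctions of menu size at most $C$. For $0\le\varepsilon<1$, let $C(n,\varepsilon)$ be the smallest $C\in\mathbb{N}$ such that $\mathrm{Rev}_C(F_1\times\cdots\times F_n)\ge(1-\varepsilon)\cdot\mathrm{Rev}(F_1\times\cdots\times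 F_n)$ for all probability distributions $F_1,\dots,F_n$ on $\mathbb{R}_{\ge 0}$ (with $C(n,\varepsilon)=\infty$ if there is none, and with the convention $c\cdot\infty=\infty$ for $c>0$). **Corollary.** For every $\alpha$ with $0<\alpha<\tfrac16$ there exist constants $d,K\in\mathbb{N}$, depending only on $\alpha$, such that $C(n,1-\alpha)\le K\cdot n^d$ for every $n\ge 1$. That is, a menu of size $O(n^d)$ suffices to extract an $\alpha$ fraction of the optimal revenue from every product distribution. -/

import Mathlib

open scoped NNReal ENNReal
open MeasureTheory

namespace MenuAuction

/-- An outcome `(x; p)` for `n` items: for each item the probability `x i ∈ [0,1]` with which the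
buyer gets it, together with the nonnegative price `p` that the buyer pays. -/
abbrev Outcome (n : ℕ) : Type := (Fin n → unitInterval) × ℝ≥0

/-- The outcome `(0; 0)`: no item is allocated and nothing is paid. -/
def nullOutcome (n : ℕ) : Outcome n := (fun _ => 0, 0)

/-- The expected utility of an additive risk-neutral buyer of type `v` from the outcome `e`. -/
def utility {n : ℕ} (e : Outcome n) (v : Fin n → ℝ≥0) : ℝ :=
  ∑ i, (e.1 i : ℝ) * (v i : ℝ) - (e.2 : ℝ)

/-- The entries of the menu `M` that maximize the utility of type `v`. -/
def bestEntries {n : ℕ} (M : Set (Outcome n)) (v : Fin n → ℝ≥0) : Set (Outcome n) :=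
  {e | e ∈ M ∧ ∀ e' ∈ M, utility e' v ≤ utility e v}

/-- A (possibly infinite) menu is an incentive-compatible and individually rational auction if it
contains `(0; 0)` and every type has a utility-maximizing entry. -/
structure IsAuction {n : ℕ} (M : Set (Outcome n)) : Prop where
  null_mem : nullOutcome n ∈ M
  exists_best : ∀ v : Fin n → ℝ≥0, (bestEntries M v).Nonempty

/-- The menu size: the number of entries other than `(0; 0)`. -/
noncomputable def menuSize {n : ℕ} (M : Set (Outcome n)) : ℕ∞ :=
  (M \ {nullOutcome n}).encard

/-- The price paid by type `v`: the price of a utility-maximizing entry, with ties broken in favor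
of higher prices. For infinite menus in which no highest tied price is attained, this is the
supremum of the tied prices. -/
noncomputable def price {n : ℕ} (M : Set (Outcome n)) (v : Fin n → ℝ≥0) : ℝ≥0∞ :=
  ⨆ e ∈ bestEntries M v, (e.2 : ℝ≥0∞)

/-- The expected revenue of the auction with menu `M` when the type is distributed by `F`. -/
noncomputable def revenue {n : ℕ} (M : Set (Outcome n)) (F : Measure (Fin n → ℝ≥0)) : ℝ≥0∞ :=
  ∫⁻ v, price M v ∂F

/-- `Rev_C(F)`: the supremum of the revenues from `F` of auctions of menu size at most `C`. -/
noncomputable def revBounded {n : ℕ} (C : ℕ) (F : Measure (Fin n → ℝ≥0)) : ℝ≥0∞ :=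
  ⨆ M ∈ {M : Set (Outcome n) | IsAuction M ∧ menuSize M ≤ C}, revenue M F

/-- `Rev(F)`: the supremum of the revenues from `F` of all auctions. -/
noncomputable def rev {n : ℕ} (F : Measure (Fin n → ℝ≥0)) : ℝ≥0∞ :=
  ⨆ M ∈ {M : Set (Outcome n) | IsAuction M}, revenue M F

/-- Menu size `C` suffices for a `1 - ε` fraction of the optimal revenue from every product
distribution `F₁ × ⋯ × Fₙ` of probability distributions on the nonnegative reals. -/
def Suffices (n : ℕ) (ε : ℝ) (C : ℕ) : Prop :=
  ∀ F : Fin n → ProbabilityMeasure ℝ≥0,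
    ENNReal.ofReal (1 - ε) * rev (Measure.pi fun i => (F i : Measure ℝ≥0)) ≤
      revBounded C (Measure.pi fun i => (F i : Measure ℝ≥0))

/-- The revenue approximation complexity `C(n, ε)`: the least menu size that suffices, and `⊤` if
no finite menu size does. -/
noncomputable def approxComplexity (n : ℕ) (ε : ℝ) : ℕ∞ :=
  ⨅ C ∈ {C : ℕ | Suffices n ε C}, (C : ℕ∞)

end MenuAuction

namespace MenuAuction

open ProbabilityTheory

/-! A core–tail decomposition bounds the optimum by two simple ways of selling. Let `R` be the sum
over items of the best posted-price revenue, and let `B` be the best revenue from menus of size at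
most `C`.

Upper bound (`rev_le_two_mul_add_core`): let `j` be the item of highest value. With the other values
fixed, an auction restricts to a single-item mechanism for `j`, so its revenue in excess of those
values is at most the posted-price revenue of `j`; summed over `j` this gives `R`. The other values
that exceed `R` contribute at most another `R`, and the rest is the core. By Chebyshev (`core_le`)
the core is at most `2R + 2B`, since posting one price for the grand bundle recovers whatever
exceeds `2R`. Hence the optimum is at most `4R + 2B`.

Lower bound (`one_sub_mul_le_revBounded`): `B ≥ (1 - 4η)R` with a menu of polynomial size. Selling
all items separately needs `2 ^ n` entries. Instead, cheap items are bundled, their total payment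
being concentrated; few expensive items sell in expectation, so allowing at most `k` of them, with
`k` depending only on `η`, loses little.

Thus the optimum is at most about `6B`, whence the bound `1/6` on `α`. -/

/-- The supremum of the revenues of posted prices for a single item. -/
noncomputable def postedRevenue (μ : Measure ℝ≥0) : ℝ≥0∞ :=
  ⨆ p : ℝ≥0, (p : ℝ≥0∞) * μ (Set.Ici p)

theorem mul_measure_Ici_le_postedRevenue (μ : Measure ℝ≥0) (p : ℝ≥0) :
    (p : ℝ≥0∞) * μ (Set.Ici p) ≤ postedRevenue μ :=
  le_iSup (fun p : ℝ≥0 => (p : ℝ≥0∞) * μ (Set.Ici p)) p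

/-! ### Single-item mechanisms: posted prices are optimal. -/

section SingleItem

variable {u x : ℝ≥0 → ℝ}

/-- With `u` the indirect utility and `x` the allocation, `x t` is a subgradient at `t`; adding its
inequality at `s` to `ha` gives `(a - x t) * (t - s) ≤ 0`. -/
theorem subgradient_mono (hux : ∀ s t : ℝ≥0, u s + x s * ((t : ℝ) - s) ≤ u t) {s t : ℝ≥0}
    (hst : s < t) {a : ℝ} (ha : u s + a * ((t : ℝ) - s) ≤ u t) : a ≤ x t := by
  have h := hux t s
  have hst' : (0 : ℝ) < (t : ℝ) - s := sub_pos.2 (by exact_mod_cast hst)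
  by_contra! hlt
  nlinarith

/-- The payments of an incentive-compatible single-item mechanism are dominated by a mixture of
posted prices on a geometric grid. -/
theorem payment_le_tsum (hx1 : ∀ t, x t ≤ 1) (hu : ∀ t, 0 ≤ u t)
    (hux : ∀ s t : ℝ≥0, u s + x s * ((t : ℝ) - s) ≤ u t) {l t₀ : ℝ≥0} (hl : 1 < l) (ht₀ : 0 < t₀)
    (s : ℝ≥0) (a : ℝ) (ha : ∀ t : ℝ≥0, u s + a * ((t : ℝ) - s) ≤ u t) :
    ENNReal.ofReal (a * s - u s) ≤ t₀ + ∑' j : ℕ,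
      ENNReal.ofReal (x (t₀ * l ^ (j + 1)) - x (t₀ * l ^ j)) *
        (Set.Ici (t₀ * l ^ j)).indicator (fun _ => ((t₀ * l ^ (j + 1) : ℝ≥0) : ℝ≥0∞)) s := by
  classical
  have hex : ∃ k : ℕ, s < t₀ * l ^ k := by
    obtain ⟨k, hk⟩ := pow_unbounded_of_one_lt (s / t₀) hl
    exact ⟨k, by rwa [div_lt_iff₀' ht₀] at hk⟩
  have hlt : s < t₀ * l ^ (Nat.find hex) := Nat.find_spec hex
  have hmin : ∀ j < Nat.find hex, t₀ * l ^ j ≤ s := fun j hj => not_lt.1 (Nat.find_min hex hj)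
  set k := Nat.find hex
  -- `x t * t - u t` is the payment at `t`. Between consecutive grid points it grows by at most the
  -- increment of `x` times the upper grid point.
  have hgrid : ∀ k : ℕ, x (t₀ * l ^ k) * (t₀ * l ^ k : ℝ≥0) - u (t₀ * l ^ k) ≤
      t₀ + ∑ j ∈ Finset.range k, (x (t₀ * l ^ (j + 1)) - x (t₀ * l ^ j)) *
        (t₀ * l ^ (j + 1) : ℝ≥0) := by
    intro k
    induction k with
    | zero =>
      have := hu t₀
      simp only [pow_zero, mul_one, Finset.range_zero, Finset.sum_empty, add_zero]
      have : x t₀ * (t₀ : ℝ) ≤ 1 * t₀ := mul_le_mul_of_nonneg_right (hx1 t₀) t₀.2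
      linarith
    | succ k ih =>
      rw [Finset.sum_range_succ]
      have := hux (t₀ * l ^ k) (t₀ * l ^ (k + 1))
      linarith
  -- The payment is monotone: `s` pays at most what the first grid point above it pays, whichever
  -- subgradient `a` is chosen at `s`.
  have hle : a * s - u s ≤ x (t₀ * l ^ k) * (t₀ * l ^ k : ℝ≥0) - u (t₀ * l ^ k) := by
    have h1 := subgradient_mono hux hlt (ha _)
    have h2 := hux (t₀ * l ^ k) s
    have h3 : 0 ≤ (x (t₀ * l ^ k) - a) * s := mul_nonneg (sub_nonneg.2 h1) s.2
    linarith
  have hmono : ∀ j : ℕ, x (t₀ * l ^ j) ≤ x (t₀ * l ^ (j + 1)) := fun j =>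
    subgradient_mono hux (mul_lt_mul_of_pos_left (pow_lt_pow_right₀ hl j.lt_succ_self) ht₀) (hux _ _)
  calc ENNReal.ofReal (a * s - u s)
      ≤ ENNReal.ofReal (t₀ + ∑ j ∈ Finset.range k, (x (t₀ * l ^ (j + 1)) - x (t₀ * l ^ j)) *
        (t₀ * l ^ (j + 1) : ℝ≥0)) := ENNReal.ofReal_le_ofReal (hle.trans (hgrid k))
    _ = t₀ + ∑ j ∈ Finset.range k, ENNReal.ofReal (x (t₀ * l ^ (j + 1)) - x (t₀ * l ^ j)) *
        ((t₀ * l ^ (j + 1) : ℝ≥0) : ℝ≥0∞) := by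
      have h0 : ∀ j ∈ Finset.range k, 0 ≤ (x (t₀ * l ^ (j + 1)) - x (t₀ * l ^ j)) *
        ((t₀ * l ^ (j + 1) : ℝ≥0) : ℝ) := fun j _ =>
          mul_nonneg (sub_nonneg.2 (hmono j)) (NNReal.coe_nonneg _)
      rw [ENNReal.ofReal_add t₀.coe_nonneg (Finset.sum_nonneg h0), ENNReal.ofReal_sum_of_nonneg h0,
        ENNReal.ofReal_coe_nnreal]
      congr 1
      refine Finset.sum_congr rfl fun j _ => ?_
      rw [ENNReal.ofReal_mul (sub_nonneg.2 (hmono j)), ENNReal.ofReal_coe_nnreal]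
    _ = t₀ + ∑ j ∈ Finset.range k, ENNReal.ofReal (x (t₀ * l ^ (j + 1)) - x (t₀ * l ^ j)) *
        (Set.Ici (t₀ * l ^ j)).indicator (fun _ => ((t₀ * l ^ (j + 1) : ℝ≥0) : ℝ≥0∞)) s := by
      congr 1
      refine Finset.sum_congr rfl fun j hj => ?_
      rw [Set.indicator_of_mem (Set.mem_Ici.2 (hmin j (Finset.mem_range.1 hj)))]
    _ ≤ _ := by gcongr; exact ENNReal.sum_le_tsum _

theorem tsum_grid_increments_le_one (hx0 : ∀ t, 0 ≤ x t) (hx1 : ∀ t, x t ≤ 1)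
    (hux : ∀ s t : ℝ≥0, u s + x s * ((t : ℝ) - s) ≤ u t) {l t₀ : ℝ≥0} (hl : 1 < l) (ht₀ : 0 < t₀) :
    ∑' j : ℕ, ENNReal.ofReal (x (t₀ * l ^ (j + 1)) - x (t₀ * l ^ j)) ≤ 1 := by
  have hmono : ∀ j : ℕ, x (t₀ * l ^ j) ≤ x (t₀ * l ^ (j + 1)) := fun j =>
    subgradient_mono hux (mul_lt_mul_of_pos_left (pow_lt_pow_right₀ hl j.lt_succ_self) ht₀) (hux _ _)
  refine ENNReal.tsum_le_of_sum_range_le fun k => ?_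
  rw [← ENNReal.ofReal_sum_of_nonneg fun j _ => sub_nonneg.2 (hmono j),
    Finset.sum_range_sub (fun j => x (t₀ * l ^ j))]
  rw [← ENNReal.ofReal_one]
  exact ENNReal.ofReal_le_ofReal (by linarith [hx1 (t₀ * l ^ k), hx0 (t₀ * l ^ 0)])

/-- No incentive-compatible single-item mechanism earns more than the best posted price. -/
theorem lintegral_payment_le_postedRevenue (μ : Measure ℝ≥0) [IsProbabilityMeasure μ]
    (hx0 : ∀ t, 0 ≤ x t) (hx1 : ∀ t, x t ≤ 1) (hu : ∀ t, 0 ≤ u t)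
    (hux : ∀ s t : ℝ≥0, u s + x s * ((t : ℝ) - s) ≤ u t) (G : ℝ≥0 → ℝ≥0∞)
    (hG : ∀ (s : ℝ≥0) (b : ℝ≥0∞), (∀ a : ℝ, (∀ t : ℝ≥0, u s + a * ((t : ℝ) - s) ≤ u t) →
      ENNReal.ofReal (a * s - u s) ≤ b) → G s ≤ b) :
    ∫⁻ s, G s ∂μ ≤ postedRevenue μ := by
  -- The grid costs `t₀` for its starting point and a factor `l` for rounding prices up; afterwards
  -- `t₀` tends to `0` and `l` to `1`.
  have key : ∀ l t₀ : ℝ≥0, 1 < l → 0 < t₀ → ∫⁻ s, G s ∂μ ≤ t₀ + l * postedRevenue μ := by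
    intro l t₀ hl ht₀
    calc ∫⁻ s, G s ∂μ ≤ ∫⁻ s, (t₀ + ∑' j : ℕ,
          ENNReal.ofReal (x (t₀ * l ^ (j + 1)) - x (t₀ * l ^ j)) *
          (Set.Ici (t₀ * l ^ j)).indicator (fun _ => ((t₀ * l ^ (j + 1) : ℝ≥0) : ℝ≥0∞)) s) ∂μ :=
          lintegral_mono fun s => hG s _ fun a ha =>
            payment_le_tsum hx1 hu hux hl ht₀ s a ha
      _ = t₀ + ∑' j : ℕ, ENNReal.ofReal (x (t₀ * l ^ (j + 1)) - x (t₀ * l ^ j)) *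
          (((t₀ * l ^ (j + 1) : ℝ≥0) : ℝ≥0∞) * μ (Set.Ici (t₀ * l ^ j))) := by
        rw [lintegral_add_left measurable_const, lintegral_const, measure_univ, mul_one,
          lintegral_tsum fun j => ((measurable_const.indicator measurableSet_Ici).const_mul
            _).aemeasurable]
        congr 1
        refine tsum_congr fun j => ?_
        rw [lintegral_const_mul _ (measurable_const.indicator measurableSet_Ici),
          lintegral_indicator_const measurableSet_Ici]
      _ ≤ t₀ + ∑' j : ℕ, ENNReal.ofReal (x (t₀ * l ^ (j + 1)) - x (t₀ * l ^ j)) *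
          (l * postedRevenue μ) := by
        refine add_le_add_right (ENNReal.tsum_le_tsum fun j => mul_le_mul_right ?_ _) _
        calc ((t₀ * l ^ (j + 1) : ℝ≥0) : ℝ≥0∞) * μ (Set.Ici (t₀ * l ^ j))
            = l * (((t₀ * l ^ j : ℝ≥0) : ℝ≥0∞) * μ (Set.Ici (t₀ * l ^ j))) := by
              push_cast; ring
          _ ≤ _ := by gcongr; exact mul_measure_Ici_le_postedRevenue _ _
      _ ≤ t₀ + 1 * (l * postedRevenue μ) := by
        rw [ENNReal.tsum_mul_right]
        gcongr
        exact tsum_grid_increments_le_one hx0 hx1 hux hl ht₀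
      _ = _ := by rw [one_mul]
  by_cases htop : postedRevenue μ = ⊤
  · simp [htop]
  lift postedRevenue μ to ℝ≥0 using htop with r
  refine ENNReal.le_of_forall_pos_le_add fun ε hε _ => ?_
  have hpos : 0 < ε / (1 + r) := by positivity
  refine (key (1 + ε / (1 + r)) (ε / (1 + r)) (lt_add_of_pos_right _ hpos) hpos).trans ?_
  norm_cast
  have : ε / (1 + r) * (1 + r) = ε := div_mul_cancel₀ _ (by positivity)
  calc ε / (1 + r) + (1 + ε / (1 + r)) * r = r + ε / (1 + r) * (1 + r) := by ring
    _ ≤ r + ε := by rw [this]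

end SingleItem

/-! ### Integration over product measures. -/

section Pi

variable {n : ℕ} (μ : Fin n → Measure ℝ≥0) [∀ i, IsProbabilityMeasure (μ i)]

/-- By independence, resampling coordinate `j` changes nothing; this lets all other values be
frozen. -/
theorem lintegral_lintegral_update (j : Fin n) {f : (Fin n → ℝ≥0) → ℝ≥0∞} (hf : Measurable f) :
    ∫⁻ v, ∫⁻ t, f (Function.update v j t) ∂μ j ∂Measure.pi μ = ∫⁻ v, f v ∂Measure.pi μ := by
  have hj : j ∉ Finset.univ.erase j := Finset.notMem_erase _ _
  have hg : Measurable fun v => ∫⁻ t, f (Function.update v j t) ∂μ j := by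
    have := hf.lmarginal μ (s := {j})
    simpa only [lmarginal_singleton] using this
  rw [lintegral_eq_lmarginal_univ 0, lintegral_eq_lmarginal_univ 0,
    ← Finset.insert_erase (Finset.mem_univ j), lmarginal_insert' _ hf hj,
    lmarginal_insert' _ hg hj]
  simp

theorem lintegral_pi_eval (i : Fin n) {f : ℝ≥0 → ℝ≥0∞} (hf : Measurable f) :
    ∫⁻ v, f (v i) ∂Measure.pi μ = ∫⁻ t, f t ∂μ i :=
  (measurePreserving_eval μ i).lintegral_comp hf

end Pi

/-! ### Upper bound on the optimal revenue by core and tail. -/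

section UpperBound

variable {n : ℕ}

/-- Utility is affine in the value of item `j`, so the allocation of `j` is a subgradient of the
indirect utility. -/
theorem utility_update (e : Outcome n) (v : Fin n → ℝ≥0) (j : Fin n) (s t : ℝ≥0) :
    utility e (Function.update v j s) + e.1 j * ((t : ℝ) - s) =
      utility e (Function.update v j t) := by
  unfold utility
  rw [← Finset.add_sum_erase _ _ (Finset.mem_univ j),
    ← Finset.add_sum_erase Finset.univ (fun i => (e.1 i : ℝ) * (Function.update v j t i : ℝ))
      (Finset.mem_univ j)]
  have : ∀ r : ℝ≥0, ∑ i ∈ Finset.univ.erase j, (e.1 i : ℝ) * (Function.update v j r i : ℝ) =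
      ∑ i ∈ Finset.univ.erase j, (e.1 i : ℝ) * (v i : ℝ) := fun r =>
    Finset.sum_congr rfl fun i hi => by rw [Function.update_of_ne (Finset.ne_of_mem_erase hi)]
  rw [this, this]
  simp only [Function.update_self]
  ring

theorem price_le_of_utility (e : Outcome n) (v : Fin n → ℝ≥0) (j : Fin n) :
    (e.2 : ℝ≥0∞) ≤ ENNReal.ofReal (e.1 j * v j - utility e v) +
      ∑ i ∈ Finset.univ.erase j, (v i : ℝ≥0∞) := by
  have h : (e.2 : ℝ) ≤ (e.1 j * v j - utility e v) +
      ((∑ i ∈ Finset.univ.erase j, v i : ℝ≥0) : ℝ) := by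
    unfold utility
    rw [← Finset.add_sum_erase _ _ (Finset.mem_univ j)]
    have : ∑ i ∈ Finset.univ.erase j, (e.1 i : ℝ) * (v i : ℝ) ≤
        ∑ i ∈ Finset.univ.erase j, (v i : ℝ) :=
      Finset.sum_le_sum fun i _ => mul_le_of_le_one_left (v i).2 (e.1 i).2.2
    push_cast
    linarith
  calc (e.2 : ℝ≥0∞) = ENNReal.ofReal e.2 := ENNReal.ofReal_coe_nnreal.symm
    _ ≤ _ := ENNReal.ofReal_le_ofReal h
    _ ≤ _ := ENNReal.ofReal_add_le
    _ = _ := by rw [ENNReal.ofReal_coe_nnreal]; push_cast; rfl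

variable (μ : Fin n → Measure ℝ≥0) [∀ i, IsProbabilityMeasure (μ i)]

/-- What an auction earns in excess of the values of all items but one is at most the posted-price
revenue of that item. -/
theorem lintegral_price_sub_le {M : Set (Outcome n)} (hM : IsAuction M) (j : Fin n)
    {g : (Fin n → ℝ≥0) → ℝ≥0∞} (hg : Measurable g) (hgM : ∀ v, g v ≤ price M v) :
    ∫⁻ v, (g v - ∑ i ∈ Finset.univ.erase j, (v i : ℝ≥0∞)) ∂Measure.pi μ ≤
      postedRevenue (μ j) := by
  have hmeas : Measurable fun v : Fin n → ℝ≥0 =>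
      g v - ∑ i ∈ Finset.univ.erase j, (v i : ℝ≥0∞) :=
    hg.sub (Finset.measurable_sum _ fun i _ => (measurable_pi_apply i).coe_nnreal_ennreal)
  rw [← lintegral_lintegral_update μ j hmeas]
  calc _ ≤ ∫⁻ _, postedRevenue (μ j) ∂Measure.pi μ := lintegral_mono fun v => ?_
    _ = _ := by simp
  choose e he using fun t : ℝ≥0 => hM.exists_best (Function.update v j t)
  refine lintegral_payment_le_postedRevenue (μ j)
    (u := fun t => utility (e t) (Function.update v j t)) (x := fun t => (e t).1 j)
    (fun t => ((e t).1 j).2.1) (fun t => ((e t).1 j).2.2) (fun t => ?_) (fun s t => ?_) _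
    (fun s b hb => ?_)
  · refine le_trans ?_ ((he t).2 _ hM.null_mem)
    simp [utility, nullOutcome]
  · rw [utility_update]
    exact (he t).2 _ (he s).1
  · rw [tsub_le_iff_right]
    refine (hgM _).trans (iSup₂_le fun e' he' => (price_le_of_utility e' (Function.update v j s) j).trans
      (add_le_add_left ?_ _))
    -- All tied entries give the same utility, so each of their allocations of `j` is a subgradient
    -- at `s`; tie-breaking is thereby covered.
    have hu : utility e' (Function.update v j s) = utility (e s) (Function.update v j s) :=
      le_antisymm ((he s).2 _ he'.1) (he'.2 _ (he s).1)
    rw [hu, Function.update_self]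
    refine hb _ fun t => ?_
    rw [← hu, utility_update]
    exact (he t).2 _ he'.1

theorem measurableSet_tail (R : ℝ≥0) (i j : Fin n) :
    MeasurableSet {v : Fin n → ℝ≥0 | R < v i ∧ v i ≤ v j} := by
  have h1 : MeasurableSet {v : Fin n → ℝ≥0 | R < v i} :=
    measurableSet_lt measurable_const (measurable_pi_apply i)
  have h2 : MeasurableSet {v : Fin n → ℝ≥0 | v i ≤ v j} :=
    measurableSet_le (measurable_pi_apply i) (measurable_pi_apply j)
  exact h1.inter h2

/-- For a fixed value `v i > R`, the inner integral over `v j` is the revenue of posting `v i` as a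
price for item `j`. -/
theorem lintegral_tail_le (R : ℝ≥0) {i j : Fin n} (hij : i ≠ j) :
    ∫⁻ v, {v : Fin n → ℝ≥0 | R < v i ∧ v i ≤ v j}.indicator (fun v => (v i : ℝ≥0∞)) v
      ∂Measure.pi μ ≤ postedRevenue (μ j) * μ i (Set.Ioi R) := by
  rw [← lintegral_lintegral_update μ j
    ((measurable_pi_apply i).coe_nnreal_ennreal.indicator (measurableSet_tail R i j))]
  calc _ ≤ ∫⁻ v, (Set.Ioi R).indicator (fun _ => postedRevenue (μ j)) (v i) ∂Measure.pi μ := by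
        refine lintegral_mono fun v => ?_
        by_cases hv : R < v i
        · rw [Set.indicator_of_mem (Set.mem_Ioi.2 hv)]
          refine le_trans (le_of_eq ?_) (mul_measure_Ici_le_postedRevenue (μ j) (v i))
          rw [← lintegral_indicator_const measurableSet_Ici]
          refine lintegral_congr fun t => ?_
          simp [Set.indicator, hij, hv]
        · simp [Set.indicator, hij, hv]
    _ = _ := by
        rw [lintegral_pi_eval μ i (measurable_const.indicator measurableSet_Ioi),
          lintegral_indicator_const measurableSet_Ioi]

/-- The optimal revenue is at most twice the revenue of separate sale plus the expected welfare of
the core. -/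
theorem rev_le_two_mul_add_core (R : ℝ≥0) (hR : ∑ i, postedRevenue (μ i) = R) :
    rev (Measure.pi μ) ≤ 2 * R +
      ∑ i, ∫⁻ t, (Set.Iic R).indicator (fun t : ℝ≥0 => (t : ℝ≥0∞)) t ∂μ i := by
  refine iSup₂_le fun M hM => ?_
  -- Measurability of `price M` is not established; a measurable minorant with the same lower
  -- integral replaces it.
  obtain ⟨g, hg, hgM, hgeq⟩ := exists_measurable_le_lintegral_eq (Measure.pi μ) (price M)
  rw [revenue, hgeq]
  have hm1 : ∀ j : Fin n, Measurable fun v : Fin n → ℝ≥0 =>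
      g v - ∑ i ∈ Finset.univ.erase j, (v i : ℝ≥0∞) := fun j =>
    hg.sub (Finset.measurable_sum _ fun i _ => (measurable_pi_apply i).coe_nnreal_ennreal)
  have hm2 : ∀ i : Fin n, Measurable fun v : Fin n → ℝ≥0 =>
      (Set.Iic R).indicator (fun t : ℝ≥0 => (t : ℝ≥0∞)) (v i) := fun i =>
    (measurable_coe_nnreal_ennreal.indicator measurableSet_Iic).comp (measurable_pi_apply i)
  have hm3 : ∀ i j : Fin n, Measurable fun v : Fin n → ℝ≥0 =>
      {v : Fin n → ℝ≥0 | R < v i ∧ v i ≤ v j}.indicator (fun v => (v i : ℝ≥0∞)) v := fun i j =>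
    (measurable_pi_apply i).coe_nnreal_ennreal.indicator (measurableSet_tail R i j)
  -- With `j` an item of maximal value, each other value is either at most `R` (core) or lies above
  -- `R` and below `v j` (tail).
  have hpt : ∀ v, g v ≤ (∑ j, (g v - ∑ i ∈ Finset.univ.erase j, (v i : ℝ≥0∞))) +
      ((∑ i, (Set.Iic R).indicator (fun t : ℝ≥0 => (t : ℝ≥0∞)) (v i)) +
      ∑ i, ∑ j ∈ Finset.univ.erase i,
        {v : Fin n → ℝ≥0 | R < v i ∧ v i ≤ v j}.indicator (fun v => (v i : ℝ≥0∞)) v) := by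
    intro v
    rcases isEmpty_or_nonempty (Fin n) with hn | hn
    · refine (hgM v).trans (iSup₂_le fun e he => ?_)
      have := (he.2 _ hM.null_mem)
      simp only [utility, nullOutcome, Finset.univ_eq_empty, Finset.sum_empty] at this ⊢
      have : (e.2 : ℝ) = 0 := le_antisymm (by simpa using this) e.2.2
      simp [NNReal.coe_eq_zero.1 this]
    obtain ⟨j, hj⟩ := Finite.exists_max v
    calc g v ≤ (g v - ∑ i ∈ Finset.univ.erase j, (v i : ℝ≥0∞)) +
          ∑ i ∈ Finset.univ.erase j, (v i : ℝ≥0∞) := le_tsub_add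
      _ ≤ _ := by
        gcongr
        · exact Finset.single_le_sum (f := fun j =>
            g v - ∑ i ∈ Finset.univ.erase j, (v i : ℝ≥0∞)) (fun _ _ => zero_le)
            (Finset.mem_univ j)
        rw [← Finset.sum_add_distrib]
        refine le_trans (Finset.sum_le_sum fun i hi => ?_)
          (Finset.sum_le_sum_of_subset (Finset.erase_subset j Finset.univ))
        by_cases hv : v i ≤ R
        · simp [hv]
        · refine le_trans ?_ le_add_self
          refine le_trans (le_of_eq ?_) (Finset.single_le_sum (f := fun j =>
            {v : Fin n → ℝ≥0 | R < v i ∧ v i ≤ v j}.indicator (fun v => (v i : ℝ≥0∞)) v)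
            (fun _ _ => zero_le)
            (Finset.mem_erase.2 ⟨(Finset.ne_of_mem_erase hi).symm, Finset.mem_univ j⟩))
          rw [Set.indicator_of_mem]
          exact ⟨not_le.1 hv, hj i⟩
  refine (lintegral_mono hpt).trans ?_
  rw [lintegral_add_left (Finset.measurable_sum _ fun j _ => hm1 j),
    lintegral_add_left (Finset.measurable_sum _ fun j _ => hm2 j),
    lintegral_finsetSum _ fun j _ => hm1 j, lintegral_finsetSum _ fun j _ => hm2 j,
    lintegral_finsetSum _ fun i _ => Finset.measurable_sum _ fun j _ => hm3 i j]
  have h1 : ∑ j, ∫⁻ v, (g v - ∑ i ∈ Finset.univ.erase j, (v i : ℝ≥0∞)) ∂Measure.pi μ ≤ R := by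
    rw [← hR]
    exact Finset.sum_le_sum fun j _ => lintegral_price_sub_le μ hM j hg hgM
  -- Summing the tail over `j` produces the factor `R`, which then serves as a posted price for item
  -- `i`.
  have h3 : ∑ i, ∫⁻ v, ∑ j ∈ Finset.univ.erase i,
      {v : Fin n → ℝ≥0 | R < v i ∧ v i ≤ v j}.indicator (fun v => (v i : ℝ≥0∞)) v
        ∂Measure.pi μ ≤ R := by
    calc _ ≤ ∑ i, postedRevenue (μ i) := Finset.sum_le_sum fun i _ => ?_
      _ = R := hR
    rw [lintegral_finsetSum _ fun j _ => hm3 i j]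
    calc _ ≤ ∑ j ∈ Finset.univ.erase i, postedRevenue (μ j) * μ i (Set.Ioi R) :=
          Finset.sum_le_sum fun j hj => lintegral_tail_le μ R (Finset.ne_of_mem_erase hj).symm
      _ ≤ ∑ j, postedRevenue (μ j) * μ i (Set.Ioi R) :=
          Finset.sum_le_sum_of_subset (Finset.erase_subset _ _)
      _ = R * μ i (Set.Ioi R) := by rw [← Finset.sum_mul, hR]
      _ ≤ R * μ i (Set.Ici R) := by gcongr; exact Set.Ioi_subset_Ici_self
      _ ≤ _ := mul_measure_Ici_le_postedRevenue _ _
  have h2 : ∑ i, ∫⁻ v, (Set.Iic R).indicator (fun t : ℝ≥0 => (t : ℝ≥0∞)) (v i) ∂Measure.pi μ =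
      ∑ i, ∫⁻ t, (Set.Iic R).indicator (fun t : ℝ≥0 => (t : ℝ≥0∞)) t ∂μ i :=
    Finset.sum_congr rfl fun i _ =>
      lintegral_pi_eval μ i (measurable_coe_nnreal_ennreal.indicator measurableSet_Iic)
  rw [h2]
  calc _ ≤ (R : ℝ≥0∞) + (∑ i, ∫⁻ t, (Set.Iic R).indicator (fun t : ℝ≥0 => (t : ℝ≥0∞)) t ∂μ i +
        R) := by gcongr
    _ = _ := by ring

end UpperBound

/-! ### Menus offering one bundle and at most `k` separate items. -/

section BundleMenu

variable {n : ℕ}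

/-- The entry that sells the items of `S` at the prices `p` and, if `b`, the bundle `A` at price
`P`. -/
def bundleEntry (A : Finset (Fin n)) (p : Fin n → ℝ≥0) (P : ℝ≥0) (S : Finset (Fin n)) (b : Bool) :
    Outcome n :=
  (fun i => if i ∈ S ∨ (b ∧ i ∈ A) then 1 else 0, ∑ i ∈ S, p i + if b then P else 0)

/-- The menu that sells at most `k` items of `L` separately at the prices `p`, and the bundle `A`
at price `P`. -/
def bundleMenu (A L : Finset (Fin n)) (p : Fin n → ℝ≥0) (P : ℝ≥0) (k : ℕ) : Set (Outcome n) :=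
  {e | ∃ S ⊆ L, S.card ≤ k ∧ ∃ b : Bool, bundleEntry A p P S b = e}

/-- A lower bound for the payment of type `v` to `bundleMenu A L p P k`. -/
noncomputable def bundlePayment (A L : Finset (Fin n)) (p : Fin n → ℝ≥0) (P : ℝ≥0) (k : ℕ)
    (v : Fin n → ℝ≥0) : ℝ≥0∞ :=
  (if P ≤ ∑ i ∈ A, v i then (P : ℝ≥0∞) else 0) +
    if (L.filter fun i => p i ≤ v i).card ≤ k then
      ∑ i ∈ L.filter fun i => p i ≤ v i, (p i : ℝ≥0∞) else 0

variable (A L : Finset (Fin n)) (p : Fin n → ℝ≥0) (P : ℝ≥0) (k : ℕ)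

/-- Since `S` and `A` are disjoint, the choice of `S` and the decision on the bundle separate. -/
theorem utility_bundleEntry {S : Finset (Fin n)} (hS : Disjoint S A) (b : Bool)
    (v : Fin n → ℝ≥0) :
    utility (bundleEntry A p P S b) v =
      ∑ i ∈ S, ((v i : ℝ) - p i) + if b then (∑ i ∈ A, (v i : ℝ)) - P else 0 := by
  have h : ∀ T : Finset (Fin n),
      ∑ i, (((if i ∈ T then 1 else 0 : unitInterval) : unitInterval) : ℝ) * (v i : ℝ) =
        ∑ i ∈ T, (v i : ℝ) := by
    intro T
    rw [← Finset.sum_subset (Finset.subset_univ T) fun i _ hi => by simp [hi]]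
    exact Finset.sum_congr rfl fun i hi => by simp [hi]
  cases b
  · simp [utility, bundleEntry, h, Finset.sum_sub_distrib]
  · have := h (S ∪ A)
    simp only [Finset.mem_union] at this
    simp only [utility, bundleEntry, true_and, this, Finset.sum_union hS, if_true,
      Finset.sum_sub_distrib]
    push_cast
    ring

theorem nullOutcome_mem_bundleMenu : nullOutcome n ∈ bundleMenu A L p P k :=
  ⟨∅, Finset.empty_subset _, by simp, false, by simp [bundleEntry, nullOutcome]⟩

variable {A L}

theorem bundleEntry_mem_bestEntries (h : Disjoint L A) {S : Finset (Fin n)} (hSL : S ⊆ L)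
    (hSk : S.card ≤ k) (v : Fin n → ℝ≥0)
    (hS : ∀ T ⊆ L, T.card ≤ k → ∑ i ∈ T, ((v i : ℝ) - p i) ≤ ∑ i ∈ S, ((v i : ℝ) - p i)) :
    bundleEntry A p P S (decide (P ≤ ∑ i ∈ A, v i)) ∈ bestEntries (bundleMenu A L p P k) v := by
  refine ⟨⟨S, hSL, hSk, _, rfl⟩, ?_⟩
  rintro _ ⟨T, hTL, hTk, b, rfl⟩
  rw [utility_bundleEntry _ _ _ (Disjoint.mono_left hTL h),
    utility_bundleEntry _ _ _ (Disjoint.mono_left hSL h)]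
  refine add_le_add (hS T hTL hTk) ?_
  have hcast : (∑ i ∈ A, (v i : ℝ)) = ((∑ i ∈ A, v i : ℝ≥0) : ℝ) := by push_cast; rfl
  rw [hcast]
  by_cases hP : P ≤ ∑ i ∈ A, v i
  · have : (P : ℝ) ≤ ((∑ i ∈ A, v i : ℝ≥0) : ℝ) := by exact_mod_cast hP
    cases b <;> simp only [hP, decide_true, if_true, Bool.false_eq_true, if_false] <;> linarith
  · have : ((∑ i ∈ A, v i : ℝ≥0) : ℝ) < P := by exact_mod_cast not_le.1 hP
    cases b <;> simp only [hP, decide_false, if_true, Bool.false_eq_true, if_false] <;> linarith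

theorem exists_bundleEntry_mem_bestEntries (h : Disjoint L A) (v : Fin n → ℝ≥0) :
    ∃ S, bundleEntry A p P S (decide (P ≤ ∑ i ∈ A, v i)) ∈
      bestEntries (bundleMenu A L p P k) v := by
  obtain ⟨S, hS, hmax⟩ := Finset.exists_max_image (L.powerset.filter fun S => S.card ≤ k)
    (fun S => ∑ i ∈ S, ((v i : ℝ) - p i)) ⟨∅, by simp⟩
  simp only [Finset.mem_filter, Finset.mem_powerset] at hS hmax
  exact ⟨S, bundleEntry_mem_bestEntries p P k h hS.1 hS.2 v fun T hTL hTk => hmax T ⟨hTL, hTk⟩⟩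

theorem isAuction_bundleMenu (h : Disjoint L A) : IsAuction (bundleMenu A L p P k) where
  null_mem := nullOutcome_mem_bundleMenu A L p P k
  exists_best v := let ⟨_, hS⟩ := exists_bundleEntry_mem_bestEntries p P k h v
    ⟨_, hS⟩

/-- If at most `k` items are affordable, buying all of them is optimal, including those with zero
surplus. Otherwise only the bundle payment is claimed, and any best choice of `S` will do. -/
theorem bundlePayment_le_price (h : Disjoint L A) (v : Fin n → ℝ≥0) :
    bundlePayment A L p P k v ≤ price (bundleMenu A L p P k) v := by
  obtain ⟨S, hS⟩ : ∃ S, bundleEntry A p P S (decide (P ≤ ∑ i ∈ A, v i)) ∈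
      bestEntries (bundleMenu A L p P k) v ∧
      (if (L.filter fun i => p i ≤ v i).card ≤ k then
        ∑ i ∈ L.filter fun i => p i ≤ v i, (p i : ℝ≥0∞) else 0) ≤ ∑ i ∈ S, (p i : ℝ≥0∞) := by
    split_ifs with hk
    · refine ⟨_, bundleEntry_mem_bestEntries p P k h (Finset.filter_subset _ _) hk v
        fun T hTL _ => ?_, le_rfl⟩
      calc ∑ i ∈ T, ((v i : ℝ) - p i) ≤ ∑ i ∈ T, max ((v i : ℝ) - p i) 0 :=
            Finset.sum_le_sum fun i _ => le_max_left _ _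
        _ ≤ ∑ i ∈ L, max ((v i : ℝ) - p i) 0 :=
            Finset.sum_le_sum_of_subset_of_nonneg hTL fun _ _ _ => le_max_right _ _
        _ = _ := by
            rw [Finset.sum_filter]
            refine Finset.sum_congr rfl fun i _ => ?_
            split_ifs with hi
            · exact max_eq_left (sub_nonneg.2 (by exact_mod_cast hi))
            · exact max_eq_right (sub_nonpos.2 (by exact_mod_cast (not_le.1 hi).le))
    · obtain ⟨S, hS⟩ := exists_bundleEntry_mem_bestEntries p P k h v
      exact ⟨S, hS, zero_le⟩
  refine le_trans ?_ (le_iSup₂ (f := fun (e : Outcome n)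
    (_ : e ∈ bestEntries (bundleMenu A L p P k) v) => (e.2 : ℝ≥0∞)) _ hS.1)
  rw [bundlePayment, add_comm]
  simp only [bundleEntry, decide_eq_true_eq]
  push_cast
  refine add_le_add hS.2 ?_
  split_ifs <;> simp

/-- A set of at most `k` items is the range of a partial listing `Fin k → Option (Fin n)`; the
factor `2` is for the bundle. -/
theorem menuSize_bundleMenu_le : menuSize (bundleMenu A L p P k) ≤ (2 * (n + 1) ^ k : ℕ) := by
  classical
  let F : (Fin k → Option (Fin n)) × Bool → Outcome n := fun x =>
    bundleEntry A p P (Finset.univ.filter fun i => ∃ a, x.1 a = some i) x.2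
  have hsub : bundleMenu A L p P k ⊆ Set.range F := by
    rintro _ ⟨S, -, hSk, b, rfl⟩
    refine ⟨(fun a => if ha : (a : ℕ) < S.card then some (S.equivFin.symm ⟨a, ha⟩ : Fin n) else none,
      b), ?_⟩
    simp only [F]
    congr 1
    ext i
    simp only [Finset.mem_filter, Finset.mem_univ, true_and]
    constructor
    · rintro ⟨a, ha⟩
      split_ifs at ha with h
      simp only [Option.some.injEq] at ha
      rw [← ha]
      exact Subtype.prop _
    · intro hi
      refine ⟨⟨S.equivFin ⟨i, hi⟩, (S.equivFin ⟨i, hi⟩).2.trans_le hSk⟩, ?_⟩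
      simp
  calc menuSize (bundleMenu A L p P k) ≤ (Set.range F).encard :=
        Set.encard_le_encard (Set.sdiff_subset.trans hsub)
    _ ≤ (Set.univ : Set ((Fin k → Option (Fin n)) × Bool)).encard := by
        rw [← Set.image_univ]; exact Set.encard_image_le _ _
    _ = _ := by
        rw [Set.encard_univ, ENat.card_eq_coe_fintype_card]
        simp [mul_comm]

theorem lintegral_bundlePayment_le_revBounded (F : Measure (Fin n → ℝ≥0)) (h : Disjoint L A)
    {C : ℕ} (hC : 2 * (n + 1) ^ k ≤ C) :
    ∫⁻ v, bundlePayment A L p P k v ∂F ≤ revBounded C F :=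
  (lintegral_mono fun v => bundlePayment_le_price p P k h v).trans
    (le_iSup₂ (f := fun (M : Set (Outcome n)) (_ : IsAuction M ∧ menuSize M ≤ C) => revenue M F) _
      ⟨isAuction_bundleMenu p P k h,
        (menuSize_bundleMenu_le p P k).trans (by exact_mod_cast hC)⟩)

end BundleMenu

/-! ### Posted prices as small menus. -/

section PostedPrices

variable {n : ℕ}

/-- The revenue of posting a price for a single bundle is attained by small menus. -/
theorem mul_measure_bundle_le_revBounded (F : Measure (Fin n → ℝ≥0)) (A : Finset (Fin n))
    (P : ℝ≥0) {C : ℕ} (hC : 2 ≤ C) :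
    (P : ℝ≥0∞) * F {v | P ≤ ∑ i ∈ A, v i} ≤ revBounded C F := by
  have hmeas : MeasurableSet {v : Fin n → ℝ≥0 | P ≤ ∑ i ∈ A, v i} :=
    measurableSet_le measurable_const (Finset.measurable_sum _ fun i _ => measurable_pi_apply i)
  refine le_trans (le_of_eq ?_) (lintegral_bundlePayment_le_revBounded (L := ∅) (A := A) 0 P 0 F
    (Finset.disjoint_empty_left _) (by simpa using hC))
  rw [← lintegral_indicator_const hmeas]
  refine lintegral_congr fun v => ?_
  simp [bundlePayment, Set.indicator]

theorem postedRevenue_le_revBounded (μ : Fin n → Measure ℝ≥0) [∀ i, IsProbabilityMeasure (μ i)]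
    (i : Fin n) {C : ℕ} (hC : 2 ≤ C) : postedRevenue (μ i) ≤ revBounded C (Measure.pi μ) := by
  refine iSup_le fun P => ?_
  rw [← (measurePreserving_eval μ i).measure_preimage measurableSet_Ici.nullMeasurableSet]
  refine le_trans (le_of_eq ?_) (mul_measure_bundle_le_revBounded (Measure.pi μ) {i} P hC)
  simp [Set.preimage]

end PostedPrices

/-! ### Concentration and second moments. -/

section Concentration

variable {n : ℕ} (μ : Fin n → Measure ℝ≥0) [∀ i, IsProbabilityMeasure (μ i)]

/-- Chebyshev's inequality for functions bounded below by a sum of independent bounded terms. -/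
theorem ofReal_one_sub_le_measure_of_sum_le {X : Fin n → ℝ≥0 → ℝ} (hX : ∀ i, Measurable (X i))
    {b : ℝ} (hX0 : ∀ i t, 0 ≤ X i t) (hXb : ∀ i t, X i t ≤ b) {Y : (Fin n → ℝ≥0) → ℝ≥0}
    (hY : ∀ v, ∑ i, X i (v i) ≤ Y v) {V : ℝ} (hV : ∑ i, ∫ t, X i t ^ 2 ∂μ i ≤ V) {a : ℝ}
    (ha : 0 < a) {P : ℝ≥0} (hP : P + a ≤ ∑ i, ∫ t, X i t ∂μ i) :
    ENNReal.ofReal (1 - V / a ^ 2) ≤ Measure.pi μ {v | P ≤ Y v} := by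
  have hb : ∀ i t, ‖X i t‖ ≤ b := fun i t => by rw [Real.norm_of_nonneg (hX0 i t)]; exact hXb i t
  have hL : ∀ i, MemLp (X i) 2 (μ i) := fun i =>
    MemLp.of_bound (hX i).aestronglyMeasurable b (ae_of_all _ (hb i))
  have hL' : ∀ i, MemLp (fun v : Fin n → ℝ≥0 => X i (v i)) 2 (Measure.pi μ) := fun i =>
    (hL i).comp_measurePreserving (measurePreserving_eval μ i)
  have hmean : (Measure.pi μ)[∑ i, fun v : Fin n → ℝ≥0 => X i (v i)] = ∑ i, ∫ t, X i t ∂μ i := by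
    simp only [Finset.sum_apply]
    rw [integral_finsetSum _ fun i _ => (hL' i).integrable one_le_two]
    refine Finset.sum_congr rfl fun i _ => ?_
    exact integral_comp_eval (hX i).aestronglyMeasurable
  have hvar : variance (∑ i, fun v : Fin n → ℝ≥0 => X i (v i)) (Measure.pi μ) ≤ V := by
    rw [variance_sum_pi hL]
    exact (Finset.sum_le_sum fun i _ =>
      variance_le_expectation_sq (hX i).aestronglyMeasurable).trans hV
  have hcheb := meas_ge_le_variance_div_sq (memLp_finsetSum' Finset.univ fun i _ => hL' i) ha
  rw [hmean] at hcheb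
  have hsub : {v | P ≤ Y v}ᶜ ⊆ {v | a ≤ |(∑ i, fun v : Fin n → ℝ≥0 => X i (v i)) v -
      ∑ i, ∫ t, X i t ∂μ i|} := by
    intro v hv
    have h1 : (Y v : ℝ) < P := by exact_mod_cast not_le.1 (Set.mem_compl_iff _ _ |>.1 hv)
    have h2 := hY v
    simp only [Set.mem_ofPred_eq, Finset.sum_apply]
    rw [abs_sub_comm]
    exact le_trans (by linarith) (le_abs_self _)
  have hV0 : 0 ≤ V / a ^ 2 := by
    have : 0 ≤ V := (variance_nonneg _ _).trans hvar
    positivity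
  rw [ENNReal.ofReal_sub _ hV0, ENNReal.ofReal_one, tsub_le_iff_right, ← measure_univ (μ := Measure.pi μ),
    ← Set.union_compl_self {v | P ≤ Y v}]
  refine (measure_union_le _ _).trans ?_
  gcongr
  exact (measure_mono hsub).trans (hcheb.trans (ENNReal.ofReal_le_ofReal (by gcongr)))

end Concentration

/-- The second moment of a truncated value is controlled by the posted-price revenue. -/
theorem lintegral_sq_le (μ : Measure ℝ≥0) {X : ℝ≥0 → ℝ} (hX : Measurable X) {R : ℝ≥0}
    (hX0 : ∀ t, 0 ≤ X t) (hXR : ∀ t, X t ≤ R) (hXt : ∀ t : ℝ≥0, X t ≤ t) :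
    ∫⁻ t, ENNReal.ofReal (X t ^ 2) ∂μ ≤ 2 * R * postedRevenue μ := by
  have h := lintegral_rpow_eq_lintegral_meas_le_mul μ (ae_of_all _ hX0) hX.aemeasurable
    (p := 2) two_pos
  simp only [Real.rpow_two] at h
  rw [h]
  -- In the layer-cake integral of `2 s μ {s ≤ X}`, the integrand is at most twice the revenue of
  -- posting price `s`, and vanishes for `s > R`.
  have hpt : ∀ s ∈ Set.Ioi (0 : ℝ), μ {a | s ≤ X a} * ENNReal.ofReal (s ^ ((2 : ℝ) - 1)) ≤
      (Set.Iic (R : ℝ)).indicator (fun _ => postedRevenue μ) s := by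
    intro s hs
    have hs1 : s ^ ((2 : ℝ) - 1) = s := by norm_num
    rw [hs1]
    by_cases hsR : s ≤ R
    · rw [Set.indicator_of_mem (Set.mem_Iic.2 hsR), mul_comm]
      refine le_trans ?_ (mul_measure_Ici_le_postedRevenue μ s.toNNReal)
      refine mul_le_mul_right (measure_mono fun a ha => ?_) _
      exact Real.toNNReal_le_iff_le_coe.2 (le_trans ha (hXt a))
    · have : {a | s ≤ X a} = ∅ := by
        ext a
        simp only [Set.mem_ofPred_eq, Set.mem_empty_iff_false, iff_false]
        exact fun ha => hsR (ha.trans (hXR a))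
      simp [this]
  calc _ ≤ ENNReal.ofReal 2 * ∫⁻ s in Set.Ioi (0 : ℝ),
        (Set.Iic (R : ℝ)).indicator (fun _ => postedRevenue μ) s := by
        gcongr 1
        exact setLIntegral_mono' measurableSet_Ioi hpt
    _ = _ := by
        rw [lintegral_indicator_const measurableSet_Iic,
          Measure.restrict_apply measurableSet_Iic, Set.inter_comm, Set.Ioi_inter_Iic,
          Real.volume_Ioc, sub_zero, ENNReal.ofReal_coe_nnreal]
        simp only [ENNReal.ofReal_ofNat]
        ring

/-! ### Welfare of the core. -/

section Core

variable {n : ℕ} (μ : Fin n → Measure ℝ≥0) [∀ i, IsProbabilityMeasure (μ i)]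

/-- The expected welfare of the core is controlled by separate sale and by bundling. -/
theorem core_le {R : ℝ≥0} (hR0 : 0 < R) (hR : ∑ i, postedRevenue (μ i) = R) {C : ℕ} (hC : 2 ≤ C) :
    ∑ i, ∫⁻ t, (Set.Iic R).indicator (fun t : ℝ≥0 => (t : ℝ≥0∞)) t ∂μ i ≤
      2 * R + 2 * revBounded C (Measure.pi μ) := by
  set X : ℝ≥0 → ℝ := fun t => (Set.Iic R).indicator (fun t : ℝ≥0 => (t : ℝ)) t with hXdef
  have hX : Measurable X := measurable_coe_nnreal_real.indicator measurableSet_Iic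
  have hX0 : ∀ t, 0 ≤ X t := fun t => Set.indicator_nonneg (fun t _ => t.coe_nonneg) t
  have hXt : ∀ t : ℝ≥0, X t ≤ t := fun t => by
    by_cases ht : t ≤ R <;> simp [hXdef, Set.indicator, ht]
  have hXR : ∀ t : ℝ≥0, X t ≤ R := fun t => by
    by_cases ht : t ≤ R <;> simp [hXdef, Set.indicator, ht]
  have hint : ∀ i, Integrable X (μ i) := fun i =>
    Integrable.of_bound hX.aestronglyMeasurable (R : ℝ)
      (ae_of_all _ fun t => by rw [Real.norm_of_nonneg (hX0 t)]; exact hXR t)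
  have hcore : ∑ i, ∫⁻ t, (Set.Iic R).indicator (fun t : ℝ≥0 => (t : ℝ≥0∞)) t ∂μ i =
      ENNReal.ofReal (∑ i, ∫ t, X t ∂μ i) := by
    rw [ENNReal.ofReal_sum_of_nonneg fun i _ => integral_nonneg hX0]
    refine Finset.sum_congr rfl fun i _ => ?_
    rw [ofReal_integral_eq_lintegral_ofReal (hint i) (ae_of_all _ hX0)]
    refine lintegral_congr fun t => ?_
    by_cases ht : t ≤ R <;> simp [hXdef, Set.indicator, ht]
  rw [hcore]
  set m := ∑ i, ∫ t, X t ∂μ i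
  have hV : ∑ i, ∫ t, X t ^ 2 ∂μ i ≤ 2 * (R : ℝ) ^ 2 := by
    have h1 : ∀ i, ENNReal.ofReal (∫ t, X t ^ 2 ∂μ i) ≤ 2 * R * postedRevenue (μ i) := by
      intro i
      rw [ofReal_integral_eq_lintegral_ofReal _ (ae_of_all _ fun t => sq_nonneg _)]
      · exact lintegral_sq_le (μ i) hX hX0 hXR hXt
      · refine Integrable.of_bound (hX.pow_const 2).aestronglyMeasurable ((R : ℝ) ^ 2)
          (ae_of_all _ fun t => ?_)
        rw [Real.norm_of_nonneg (sq_nonneg _)]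
        exact pow_le_pow_left₀ (hX0 t) (hXR t) 2
    have h2 : ENNReal.ofReal (∑ i, ∫ t, X t ^ 2 ∂μ i) ≤ ENNReal.ofReal (2 * (R : ℝ) ^ 2) := by
      rw [ENNReal.ofReal_sum_of_nonneg fun i _ => integral_nonneg fun t => sq_nonneg _]
      refine (Finset.sum_le_sum fun i _ => h1 i).trans (le_of_eq ?_)
      rw [← Finset.mul_sum, hR, ENNReal.ofReal_mul zero_le_two,
        ENNReal.ofReal_pow R.coe_nonneg, ENNReal.ofReal_coe_nnreal, ENNReal.ofReal_ofNat]
      ring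
    exact (ENNReal.ofReal_le_ofReal_iff (by positivity)).1 h2
  -- If `m > 2R`, the grand bundle is priced at `m - 2R`. The variance is at most `2R²` and the
  -- deviation `2R`, so it sells with probability at least `1/2`.
  rcases le_or_gt m (2 * R) with hm | hm
  · refine le_trans (ENNReal.ofReal_le_ofReal hm) (le_trans (le_of_eq ?_) le_self_add)
    rw [ENNReal.ofReal_mul zero_le_two, ENNReal.ofReal_coe_nnreal, ENNReal.ofReal_ofNat]
  · have hR0' : (0 : ℝ) < R := by exact_mod_cast hR0
    have hPcoe : ((m - 2 * R).toNNReal : ℝ) = m - 2 * R := Real.coe_toNNReal _ (by linarith)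
    have hch := ofReal_one_sub_le_measure_of_sum_le μ (X := fun _ => X) (fun _ => hX)
      (fun _ => hX0) (fun _ => hXR) (Y := fun v => ∑ i, v i)
      (fun v => by push_cast; exact Finset.sum_le_sum fun i _ => hXt _) hV (a := 2 * R)
      (by positivity) (P := (m - 2 * R).toNNReal) (by rw [hPcoe]; linarith)
    have hhalf : 1 - 2 * (R : ℝ) ^ 2 / (2 * R) ^ 2 = 1 / 2 := by field_simp; norm_num
    rw [hhalf] at hch
    calc ENNReal.ofReal m = ENNReal.ofReal (2 * R + 2 * ((m - 2 * R) * (1 / 2))) := by ring_nf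
      _ = 2 * R + 2 * (((m - 2 * R).toNNReal : ℝ≥0∞) * ENNReal.ofReal (1 / 2)) := by
        rw [ENNReal.ofReal_add (by positivity) (by linarith), ENNReal.ofReal_mul zero_le_two,
          ENNReal.ofReal_mul zero_le_two, ENNReal.ofReal_mul (by linarith),
          ENNReal.ofReal_coe_nnreal, ENNReal.ofReal_ofNat]
        rfl
      _ ≤ 2 * R + 2 * revBounded C (Measure.pi μ) := by
        gcongr
        refine le_trans (mul_le_mul_right hch _) ?_
        exact mul_measure_bundle_le_revBounded _ Finset.univ _ hC

end Core

/-! ### Approximating separate sale, and the final accounting. -/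

section SeparateSale

variable {n : ℕ}

/-- When more than `k` items are affordable, each has at least `k` affordable companions, so `k⁻¹`
times the number of companions is at least `1`. -/
theorem sum_posted_le (L : Finset (Fin n)) (p : Fin n → ℝ≥0) {k : ℕ} (hk : 0 < k)
    (v : Fin n → ℝ≥0) :
    ∑ i ∈ L, (if p i ≤ v i then (p i : ℝ≥0∞) else 0) ≤
      (if (L.filter fun i => p i ≤ v i).card ≤ k then
        ∑ i ∈ L.filter fun i => p i ≤ v i, (p i : ℝ≥0∞) else 0) +
      (k : ℝ≥0∞)⁻¹ * ∑ i ∈ L, ∑ j ∈ L.erase i,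
        if p i ≤ v i ∧ p j ≤ v j then (p i : ℝ≥0∞) else 0 := by
  rw [← Finset.sum_filter]
  split_ifs with h
  · exact le_self_add
  · rw [zero_add, Finset.mul_sum, Finset.sum_filter]
    refine Finset.sum_le_sum fun i hi => ?_
    split_ifs with hpi
    · have hcard : k ≤ ((L.erase i).filter fun j => p j ≤ v j).card := by
        rw [Finset.filter_erase, Finset.card_erase_of_mem (Finset.mem_filter.2 ⟨hi, hpi⟩)]
        omega
      simp only [hpi, true_and]
      rw [← Finset.sum_filter, Finset.sum_const, nsmul_eq_mul, ← mul_assoc]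
      refine le_mul_of_one_le_left zero_le ?_
      rw [← ENNReal.inv_mul_cancel (a := (k : ℝ≥0∞)) (by exact_mod_cast hk.ne')
        (ENNReal.natCast_ne_top k)]
      gcongr
    · exact zero_le

variable (μ : Fin n → Measure ℝ≥0) [∀ i, IsProbabilityMeasure (μ i)]

theorem measure_pi_pair (p : Fin n → ℝ≥0) {i j : Fin n} (hij : i ≠ j) :
    Measure.pi μ {v | p i ≤ v i ∧ p j ≤ v j} = μ i (Set.Ici (p i)) * μ j (Set.Ici (p j)) := by
  have hind : iIndepFun (fun (i : Fin n) (v : Fin n → ℝ≥0) => v i) (Measure.pi μ) :=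
    iIndepFun_pi (X := fun _ x => x) fun i => aemeasurable_id
  have h := (hind.indepFun hij).measure_inter_preimage_eq_mul (Set.Ici (p i)) (Set.Ici (p j))
    measurableSet_Ici measurableSet_Ici
  have he := fun i => (measurePreserving_eval μ i).measure_preimage
    (measurableSet_Ici (a := p i)).nullMeasurableSet
  refine h.trans ?_
  rw [← he i, ← he j]

theorem measurableSet_le_coord (p : ℝ≥0) (i : Fin n) :
    MeasurableSet {v : Fin n → ℝ≥0 | p ≤ v i} :=
  measurableSet_le measurable_const (measurable_pi_apply i)

/-- Selling at most `k` items of `L` loses little compared to selling all of them. -/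
theorem sum_mul_measure_le (L : Finset (Fin n)) (p : Fin n → ℝ≥0) {k : ℕ} (hk : 0 < k) :
    ∑ i ∈ L, (p i : ℝ≥0∞) * μ i (Set.Ici (p i)) ≤
      ∫⁻ v, (if (L.filter fun i => p i ≤ v i).card ≤ k then
        ∑ i ∈ L.filter fun i => p i ≤ v i, (p i : ℝ≥0∞) else 0) ∂Measure.pi μ +
      (k : ℝ≥0∞)⁻¹ * ((∑ i ∈ L, (p i : ℝ≥0∞) * μ i (Set.Ici (p i))) *
        ∑ j ∈ L, μ j (Set.Ici (p j))) := by
  have hm1 : ∀ i : Fin n, Measurable fun v : Fin n → ℝ≥0 =>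
      if p i ≤ v i then (p i : ℝ≥0∞) else 0 := fun i =>
    Measurable.ite (measurableSet_le_coord (p i) i) measurable_const measurable_const
  have hs2 : ∀ i j : Fin n, MeasurableSet {v : Fin n → ℝ≥0 | p i ≤ v i ∧ p j ≤ v j} :=
    fun i j => (measurableSet_le_coord (p i) i).inter (measurableSet_le_coord (p j) j)
  have hm2 : ∀ i j : Fin n, Measurable fun v : Fin n → ℝ≥0 =>
      if p i ≤ v i ∧ p j ≤ v j then (p i : ℝ≥0∞) else 0 := fun i j =>
    Measurable.ite (hs2 i j) measurable_const measurable_const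
  have hm3 : Measurable fun v : Fin n → ℝ≥0 => ∑ i ∈ L, ∑ j ∈ L.erase i,
      if p i ≤ v i ∧ p j ≤ v j then (p i : ℝ≥0∞) else 0 :=
    Finset.measurable_sum _ fun i _ => Finset.measurable_sum _ fun j _ => hm2 i j
  have h1 : ∫⁻ v, ∑ i ∈ L, (if p i ≤ v i then (p i : ℝ≥0∞) else 0) ∂Measure.pi μ =
      ∑ i ∈ L, (p i : ℝ≥0∞) * μ i (Set.Ici (p i)) := by
    rw [lintegral_finsetSum _ fun i _ => hm1 i]
    refine Finset.sum_congr rfl fun i _ => ?_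
    rw [← lintegral_indicator_const measurableSet_Ici,
      ← lintegral_pi_eval μ i (measurable_const.indicator measurableSet_Ici)]
    rfl
  -- Distinct items are independent; restoring the diagonal terms makes the bound a product.
  have h2 : ∫⁻ v, ∑ i ∈ L, ∑ j ∈ L.erase i,
      (if p i ≤ v i ∧ p j ≤ v j then (p i : ℝ≥0∞) else 0) ∂Measure.pi μ ≤
      (∑ i ∈ L, (p i : ℝ≥0∞) * μ i (Set.Ici (p i))) * ∑ j ∈ L, μ j (Set.Ici (p j)) := by
    rw [lintegral_finsetSum _ fun i _ => Finset.measurable_sum _ fun j _ => hm2 i j,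
      Finset.sum_mul]
    refine Finset.sum_le_sum fun i _ => ?_
    rw [lintegral_finsetSum _ fun j _ => hm2 i j, Finset.mul_sum]
    refine le_trans (Finset.sum_le_sum fun j hj => le_of_eq ?_)
      (Finset.sum_le_sum_of_subset (Finset.erase_subset i L))
    rw [mul_assoc, ← measure_pi_pair μ p (Finset.ne_of_mem_erase hj).symm,
      ← lintegral_indicator_const (hs2 i j)]
    exact lintegral_congr fun v => by simp [Set.indicator]
  rw [← h1]
  refine (lintegral_mono fun v => sum_posted_le L p hk v).trans ?_
  rw [lintegral_add_right _ (hm3.const_mul _), lintegral_const_mul _ hm3, h1]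
  gcongr

/-- Cheap items can be bundled with little loss compared to selling them separately. -/
theorem ofReal_sub_le_bundle (A : Finset (Fin n)) (p : Fin n → ℝ≥0) {η R : ℝ} (hη : 0 < η)
    (hR : 0 < R) (hp : ∀ i ∈ A, p i ≤ η ^ 3 * R)
    (hAR : ∑ i ∈ A, p i * (μ i).real (Set.Ici (p i)) ≤ R) :
    ∃ P : ℝ≥0, ENNReal.ofReal (∑ i ∈ A, p i * (μ i).real (Set.Ici (p i)) - 2 * η * R) ≤
      P * Measure.pi μ {v | P ≤ ∑ i ∈ A, v i} := by
  set s := ∑ i ∈ A, p i * (μ i).real (Set.Ici (p i)) with hs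
  rcases le_or_gt s (η * R) with hle | hlt
  · refine ⟨0, ?_⟩
    rw [ENNReal.ofReal_of_nonpos (by nlinarith [mul_pos hη hR])]
    exact zero_le
  -- `X i` is the payment for item `i` at price `p i`. It is at most `η³R`, so the second moments
  -- sum to at most `η³R²`, and a deviation of `ηR` has probability at most `η`.
  set X : Fin n → ℝ≥0 → ℝ := fun i =>
    if i ∈ A then (Set.Ici (p i)).indicator fun _ => (p i : ℝ) else 0 with hXdef
  have hXA : ∀ i ∈ A, X i = (Set.Ici (p i)).indicator fun _ => (p i : ℝ) := fun i hi => by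
    simp [hXdef, hi]
  have hXnA : ∀ i ∉ A, X i = 0 := fun i hi => by simp [hXdef, hi]
  have hX : ∀ i, Measurable (X i) := fun i => by
    by_cases hi : i ∈ A
    · rw [hXA i hi]; exact measurable_const.indicator measurableSet_Ici
    · rw [hXnA i hi]; exact measurable_const
  have hX0 : ∀ i t, 0 ≤ X i t := fun i t => by
    by_cases hi : i ∈ A
    · rw [hXA i hi]; exact Set.indicator_nonneg (fun _ _ => (p i).coe_nonneg) t
    · rw [hXnA i hi]; exact le_rfl
  have hXb : ∀ i t, X i t ≤ η ^ 3 * R := fun i t => by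
    by_cases hi : i ∈ A
    · rw [hXA i hi]
      exact (Set.indicator_le_self' (fun _ _ => (p i).coe_nonneg) t).trans (hp i hi)
    · rw [hXnA i hi]; exact by positivity
  have hXsum : ∀ v : Fin n → ℝ≥0, ∑ i, X i (v i) ≤ ((∑ i ∈ A, v i : ℝ≥0) : ℝ) := fun v => by
    rw [← Finset.sum_subset (Finset.subset_univ A) fun i _ hi => by rw [hXnA i hi]; rfl]
    push_cast
    refine Finset.sum_le_sum fun i hi => ?_
    rw [hXA i hi]
    by_cases h : p i ≤ v i
    · simp [Set.indicator, h]
    · simp [Set.indicator, h]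
  have hXint : ∑ i, ∫ t, X i t ∂μ i = s := by
    rw [← Finset.sum_subset (Finset.subset_univ A) fun i _ hi => by simp [hXnA i hi]]
    refine Finset.sum_congr rfl fun i hi => ?_
    rw [hXA i hi, integral_indicator_const _ measurableSet_Ici, smul_eq_mul, mul_comm]
  have hXsq : ∑ i, ∫ t, X i t ^ 2 ∂μ i ≤ η ^ 3 * R * R := by
    calc ∑ i, ∫ t, X i t ^ 2 ∂μ i ≤ ∑ i, η ^ 3 * R * ∫ t, X i t ∂μ i := by
          refine Finset.sum_le_sum fun i _ => ?_
          have hI : ∀ Z : ℝ≥0 → ℝ, Measurable Z → ∀ b : ℝ, (∀ t, 0 ≤ Z t) → (∀ t, Z t ≤ b) →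
              Integrable Z (μ i) := fun Z hZ b h0 hb =>
            Integrable.of_bound hZ.aestronglyMeasurable b
              (ae_of_all _ fun t => by rw [Real.norm_of_nonneg (h0 t)]; exact hb t)
          rw [← integral_const_mul]
          refine integral_mono (hI _ ((hX i).pow_const 2) ((η ^ 3 * R) ^ 2)
            (fun t => sq_nonneg _) fun t => pow_le_pow_left₀ (hX0 i t) (hXb i t) 2)
            ((hI _ (hX i) _ (hX0 i) (hXb i)).const_mul _) fun t => ?_
          simp only [sq]
          exact mul_le_mul_of_nonneg_right (hXb i t) (hX0 i t)
      _ = η ^ 3 * R * s := by rw [← Finset.mul_sum, hXint]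
      _ ≤ _ := by gcongr
  have hPcoe : ((s - η * R).toNNReal : ℝ) = s - η * R := Real.coe_toNNReal _ (by linarith)
  refine ⟨(s - η * R).toNNReal, ?_⟩
  have hch := ofReal_one_sub_le_measure_of_sum_le μ hX hX0 hXb
    (Y := fun v => ∑ i ∈ A, v i) hXsum hXsq (a := η * R) (by positivity)
    (P := (s - η * R).toNNReal) (by rw [hPcoe, hXint]; linarith)
  have heta : 1 - η ^ 3 * R * R / (η * R) ^ 2 = 1 - η := by field_simp
  rw [heta] at hch
  refine le_trans ?_ (mul_le_mul_right hch _)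
  change _ ≤ ENNReal.ofReal (s - η * R) * _
  rw [← ENNReal.ofReal_mul (by linarith)]
  refine ENNReal.ofReal_le_ofReal ?_
  -- `(s - ηR)(1 - η) ≥ s - 2ηR` because `s ≤ R`.
  nlinarith [mul_pos hη hR, mul_nonneg hη.le (sub_nonneg.2 hAR), mul_pos hη (mul_pos hη hR)]

theorem exists_price_near_postedRevenue (μ : Measure ℝ≥0) {η : ℝ} (hη : 0 < η)
    (h : postedRevenue μ ≠ ⊤) :
    ∃ p : ℝ≥0, ENNReal.ofReal (1 - η) * postedRevenue μ ≤ p * μ (Set.Ici p) := by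
  by_cases h0 : postedRevenue μ = 0
  · exact ⟨0, by simp [h0]⟩
  have hlt : ENNReal.ofReal (1 - η) * postedRevenue μ < postedRevenue μ := by
    conv_rhs => rw [← one_mul (postedRevenue μ)]
    refine ENNReal.mul_lt_mul_left h0 h ?_
    rw [← ENNReal.ofReal_one]
    exact (ENNReal.ofReal_lt_ofReal_iff one_pos).2 (by linarith)
  obtain ⟨p, hp⟩ := lt_iSup_iff.1 hlt
  exact ⟨p, hp.le⟩

/-- Menus of polynomial size extract nearly all the revenue of separate sale. -/
theorem one_sub_mul_le_revBounded {R : ℝ≥0} (hR0 : 0 < R) (hR : ∑ i, postedRevenue (μ i) = R)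
    {η : ℝ} (hη : 0 < η) (hη1 : η < 1) {k : ℕ} (hk : 1 / η ^ 4 ≤ k) {C : ℕ}
    (hC : 2 * (n + 1) ^ k ≤ C) :
    ENNReal.ofReal ((1 - 4 * η) * R) ≤ revBounded C (Measure.pi μ) := by
  have hR0' : (0 : ℝ) < R := by exact_mod_cast hR0
  have hk0 : 0 < k := by
    have : (0 : ℝ) < k := lt_of_lt_of_le (by positivity) hk
    exact_mod_cast this
  have hfin : ∀ i, postedRevenue (μ i) ≠ ⊤ := fun i =>
    ne_top_of_le_ne_top (ENNReal.coe_ne_top (r := R))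
      (hR ▸ Finset.single_le_sum (f := fun i => postedRevenue (μ i)) (fun _ _ => zero_le)
        (Finset.mem_univ i))
  choose p hp using fun i => exists_price_near_postedRevenue (μ i) hη (hfin i)
  set w : Fin n → ℝ := fun i => p i * (μ i).real (Set.Ici (p i)) with hw
  have hw0 : ∀ i, 0 ≤ w i := fun i => by positivity
  have hwE : ∀ i, ENNReal.ofReal (w i) = p i * μ i (Set.Ici (p i)) := fun i => by
    rw [ENNReal.ofReal_mul (p i).coe_nonneg, ENNReal.ofReal_coe_nnreal, ofReal_measureReal]
  have hwlow : (1 - η) * R ≤ ∑ i, w i := by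
    rw [← ENNReal.ofReal_le_ofReal_iff (Finset.sum_nonneg fun i _ => hw0 i),
      ENNReal.ofReal_mul (by linarith), ENNReal.ofReal_coe_nnreal, ← hR, Finset.mul_sum,
      ENNReal.ofReal_sum_of_nonneg fun i _ => hw0 i]
    exact Finset.sum_le_sum fun i _ => (hp i).trans_eq (hwE i).symm
  have hwup : ∑ i, w i ≤ R := by
    rw [← ENNReal.ofReal_le_ofReal_iff hR0'.le, ENNReal.ofReal_coe_nnreal, ← hR,
      ENNReal.ofReal_sum_of_nonneg fun i _ => hw0 i]
    exact Finset.sum_le_sum fun i _ =>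
      (hwE i).trans_le (mul_measure_Ici_le_postedRevenue _ _)
  set A := Finset.univ.filter fun i => (p i : ℝ) ≤ η ^ 3 * R with hA
  set L := Finset.univ.filter fun i => ¬ (p i : ℝ) ≤ η ^ 3 * R with hL
  have hLA : Disjoint L A := (Finset.disjoint_filter_filter_not _ _ _).symm
  have hsplit : ∑ i ∈ A, w i + ∑ i ∈ L, w i = ∑ i, w i :=
    Finset.sum_filter_add_sum_filter_not _ _ _
  have hA0 : 0 ≤ ∑ i ∈ A, w i := Finset.sum_nonneg fun i _ => hw0 i
  have hL0 : 0 ≤ ∑ i ∈ L, w i := Finset.sum_nonneg fun i _ => hw0 i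
  obtain ⟨P, hP⟩ := ofReal_sub_le_bundle μ A p hη hR0' (fun i hi => (Finset.mem_filter.1 hi).2)
    (show ∑ i ∈ A, w i ≤ R by linarith)
  have hlarge := sum_mul_measure_le μ L p hk0
  set I := ∫⁻ v, (if (L.filter fun i => p i ≤ v i).card ≤ k then
        ∑ i ∈ L.filter fun i => p i ≤ v i, (p i : ℝ≥0∞) else 0) ∂Measure.pi μ with hI
  -- Each item of `L` costs more than `η³R` and together they earn at most `R`, so the expected
  -- number sold is at most `1/η³`; then `k ≥ 1/η⁴` makes the truncation loss at most `ηR`.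
  have hq : ∑ j ∈ L, (μ j).real (Set.Ici (p j)) ≤ 1 / η ^ 3 := by
    have h1 : η ^ 3 * R * ∑ j ∈ L, (μ j).real (Set.Ici (p j)) ≤ R := by
      rw [Finset.mul_sum]
      refine le_trans (Finset.sum_le_sum fun j hj => ?_) (show ∑ j ∈ L, w j ≤ R by linarith)
      exact mul_le_mul_of_nonneg_right (not_le.1 (Finset.mem_filter.1 hj).2).le measureReal_nonneg
    rw [le_div_iff₀ (by positivity)]
    have h2 : R * ((∑ j ∈ L, (μ j).real (Set.Ici (p j))) * η ^ 3) ≤ (R : ℝ) * 1 := by linarith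
    exact le_of_mul_le_mul_left h2 hR0'
  have hloss : (k : ℝ)⁻¹ * ((∑ i ∈ L, w i) * ∑ j ∈ L, (μ j).real (Set.Ici (p j))) ≤ η * R := by
    have hk' : (0 : ℝ) < k := by exact_mod_cast hk0
    calc _ ≤ (k : ℝ)⁻¹ * (R * (1 / η ^ 3)) := by gcongr; linarith
      _ ≤ (1 / η ^ 4)⁻¹ * (R * (1 / η ^ 3)) := by gcongr
      _ = _ := by field_simp
  have hlarge' : ENNReal.ofReal (∑ i ∈ L, w i) ≤ I + ENNReal.ofReal (η * R) := by
    have hsumL : ENNReal.ofReal (∑ i ∈ L, w i) = ∑ i ∈ L, (p i : ℝ≥0∞) * μ i (Set.Ici (p i)) := by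
      rw [ENNReal.ofReal_sum_of_nonneg fun i _ => hw0 i]
      exact Finset.sum_congr rfl fun i _ => hwE i
    have hsumq : ENNReal.ofReal (∑ j ∈ L, (μ j).real (Set.Ici (p j))) =
        ∑ j ∈ L, μ j (Set.Ici (p j)) := by
      rw [ENNReal.ofReal_sum_of_nonneg fun i _ => measureReal_nonneg]
      exact Finset.sum_congr rfl fun i _ => ofReal_measureReal
    rw [← hsumL, ← hsumq, ← ENNReal.ofReal_mul hL0, ← ENNReal.ofReal_natCast,
      ← ENNReal.ofReal_inv_of_pos (by exact_mod_cast hk0),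
      ← ENNReal.ofReal_mul (by positivity)] at hlarge
    exact hlarge.trans (by gcongr)
  refine le_trans ?_ (lintegral_bundlePayment_le_revBounded p P k (Measure.pi μ) hLA hC)
  have hmeas : MeasurableSet {v : Fin n → ℝ≥0 | P ≤ ∑ i ∈ A, v i} :=
    measurableSet_le measurable_const (Finset.measurable_sum _ fun i _ => measurable_pi_apply i)
  have hint : ∫⁻ v, bundlePayment A L p P k v ∂Measure.pi μ =
      P * Measure.pi μ {v | P ≤ ∑ i ∈ A, v i} + I := by
    unfold bundlePayment
    rw [lintegral_add_left (Measurable.ite hmeas measurable_const measurable_const),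
      ← lintegral_indicator_const hmeas]
    rfl
  rw [hint]
  -- The loss of `4ηR` is `ηR` for near-optimal prices, `2ηR` for bundling and `ηR` for the limit
  -- `k`.
  calc ENNReal.ofReal ((1 - 4 * η) * R)
      ≤ ENNReal.ofReal ((∑ i ∈ A, w i - 2 * η * R) + (∑ i ∈ L, w i - η * R)) :=
        ENNReal.ofReal_le_ofReal (by linarith)
    _ ≤ _ := ENNReal.ofReal_add_le
    _ ≤ _ := by
        refine add_le_add hP ?_
        rw [ENNReal.ofReal_sub _ (by positivity)]
        exact tsub_le_iff_right.2 hlarge'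

/-- A menu of polynomial size extracts any fraction below `1 / 6` of the optimal revenue. -/
theorem ofReal_mul_rev_le_revBounded {α : ℝ} (hα : 0 < α) (hα6 : α < 1 / 6) {k : ℕ}
    (hk : 1 / ((1 - 6 * α) / 4) ^ 4 ≤ k) {C : ℕ} (hC : 2 * (n + 1) ^ k ≤ C) :
    ENNReal.ofReal α * rev (Measure.pi μ) ≤ revBounded C (Measure.pi μ) := by
  have hC2 : 2 ≤ C := le_trans (Nat.le_mul_of_pos_right 2 (by positivity)) hC
  by_cases htop : ∑ i, postedRevenue (μ i) = ⊤
  · obtain ⟨i, -, hi⟩ := ENNReal.sum_eq_top.1 htop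
    exact le_top.trans (hi ▸ postedRevenue_le_revBounded μ i hC2)
  obtain ⟨R, hR⟩ : ∃ R : ℝ≥0, (R : ℝ≥0∞) = ∑ i, postedRevenue (μ i) :=
    ⟨_, ENNReal.coe_toNNReal htop⟩
  have hrev := rev_le_two_mul_add_core μ R hR.symm
  rcases eq_or_lt_of_le (zero_le (a := R)) with rfl | hR0
  · have : rev (Measure.pi μ) = 0 := by
      refine le_antisymm (hrev.trans (le_of_eq ?_)) zero_le
      simp only [ENNReal.coe_zero, mul_zero, zero_add]
      refine Finset.sum_eq_zero fun i _ => ?_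
      rw [← lintegral_zero (μ := μ i)]
      refine lintegral_congr fun t => ?_
      by_cases ht : t ≤ 0
      · simp [nonpos_iff_eq_zero.1 ht]
      · simp [ht]
    simp [this]
  -- This `η` makes `1 - 4η = 6α`.
  have hsep := one_sub_mul_le_revBounded μ hR0 hR.symm (η := (1 - 6 * α) / 4) (by linarith)
    (by linarith) hk hC
  have hcore := core_le μ hR0 hR.symm hC2
  set B := revBounded C (Measure.pi μ)
  have hR0' : (0 : ℝ) < R := by exact_mod_cast hR0
  have hsep' : ENNReal.ofReal (6 * α) * R ≤ B := by
    rw [← ENNReal.ofReal_coe_nnreal, ← ENNReal.ofReal_mul (by linarith)]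
    convert hsep using 3
    ring
  calc ENNReal.ofReal α * rev (Measure.pi μ)
      ≤ ENNReal.ofReal α * (2 * R + (2 * R + 2 * B)) := by gcongr; exact hrev.trans (by gcongr)
    _ = ENNReal.ofReal (2 / 3) * (ENNReal.ofReal (6 * α) * R) + ENNReal.ofReal (2 * α) * B := by
        rw [← mul_assoc, ← ENNReal.ofReal_mul (by norm_num), ENNReal.ofReal_mul zero_le_two,
          show 2 / 3 * (6 * α) = 4 * α by ring, ENNReal.ofReal_mul zero_le_four]
        simp only [ENNReal.ofReal_ofNat]
        ring
    _ ≤ ENNReal.ofReal (2 / 3) * B + ENNReal.ofReal (2 * α) * B := by gcongr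
    _ = ENNReal.ofReal (2 / 3 + 2 * α) * B := by
        rw [← add_mul, ← ENNReal.ofReal_add (by norm_num) (by linarith)]
    _ ≤ 1 * B := by
        gcongr
        rw [← ENNReal.ofReal_one]
        exact ENNReal.ofReal_le_ofReal (by linarith)
    _ = B := one_mul B

end SeparateSale

end MenuAuction

theorem mainTheorem4 :
    ∀ α : ℝ, 0 < α → α < 1 / 6 →
      ∃ d K : ℕ, ∀ n : ℕ, 1 ≤ n →
        MenuAuction.approxComplexity n (1 - α) ≤ (K : ℕ∞) * (n : ℕ∞) ^ d := by
  intro α hα hα6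
  obtain ⟨k, hk⟩ := exists_nat_ge (1 / ((1 - 6 * α) / 4) ^ 4)
  refine ⟨k, 2 * 2 ^ k, fun n hn => ?_⟩
  have hsuff : MenuAuction.Suffices n (1 - α) (2 * 2 ^ k * n ^ k) := by
    intro F
    rw [sub_sub_cancel]
    refine MenuAuction.ofReal_mul_rev_le_revBounded _ hα hα6 hk ?_
    -- `n + 1 ≤ 2n` because `n ≥ 1`, which is where the constant `2 * 2 ^ k` comes from.
    rw [mul_assoc, ← mul_pow]
    gcongr
    omega
  refine (iInf₂_le (2 * 2 ^ k * n ^ k) hsuff).trans (le_of_eq ?_)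
  push_cast
  rfl
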